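/- Let $l\ge 1$ be an integer, $\lambda_0>0$ and $\varepsilon>0$. A homogeneous $l$-D shotgun cellular system (SCS) with density $\lambda_0$ consists of base stations located at the points $X_1,X_2,\dots$ of a homogeneous Poisson point process in $\mathbb R^l$ of intensity $\lambda_0$, with nonnegative random transmission powers $K_i$ and shadow fading factors $\Psi_i$ such that the pairs $(K_i,\Psi_i)$ are i.i.d. across base stations and independent of the locations ($K_i$ and $\Psi_i$ of the same base station may be dependent). The power received at the origin from base station $i$ is $p_i=K_i\Psi_i\|X_i\|^{-\varepsilon}$, and the carrier-to-interference ratio there is $$\frac CI=\frac{p_S}{\sum_{i\neq S}p_i},$$ where $S$ is the index of a base station with the strongest received power (the ratio is $0$ if the sum diverges). Let $(K,\Psi)$ be distributed as $(K_i,\Psi_i)$. If $\mathbb P(\Psi K>0)>0$ and $\mathbb E\big[(\Psi K)^{l/\varepsilon}\big]<\infty$, then almost surely a base station with the strongest received power exists, and the distribution of $\frac CI$ does not depend on the joint distribution of $(K,\Psi)$: any two homogeneous $l$-D SCSs with the same $\lambda_0$ and $\varepsilon$ (but possibly different distributions of $(K,\Psi)$) that satisfy these two conditions have the same $\frac CI$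 distribution. -/

import Mathlib

open MeasureTheory ProbabilityTheory
open scoped ENNReal NNReal

noncomputable section

/-- The number of indices `i` (points counted with multiplicity) such that the point `x i` of the
configuration `x` lies in `A`. -/
def pointCount {E : Type*} (x : ℕ → E) (A : Set E) : ℕ∞ :=
  {i | x i ∈ A}.encard

/-- The random points `X 0, X 1, …` form (in some measurable enumeration) a homogeneous Poisson
point process in `ℝˡ` with constant intensity `lam`: the number of points in a Borel set of finite
volume is Poisson distributed with mean `lam` times the volume, and the numbers of points in
pairwise disjoint Borel sets are independent.  (For `lam > 0` and `l ≥ 1` such a process has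
infinitely many points almost surely, so it can be enumerated by `ℕ`.) -/
structure IsHomogeneousPoisson {Ω : Type*} [MeasurableSpace Ω] (l : ℕ) (lam : ℝ)
    (X : ℕ → Ω → EuclideanSpace ℝ (Fin l)) (P : Measure Ω) : Prop where
  measurable : ∀ i, Measurable (X i)
  poisson : ∀ A : Set (EuclideanSpace ℝ (Fin l)), MeasurableSet A → volume A ≠ ∞ → ∀ n : ℕ,
    P {ω | pointCount (fun i => X i ω) A = n} =
      poissonMeasure (Real.toNNReal lam * (volume A).toNNReal) {n}
  indep : ∀ (m : ℕ) (A : Fin m → Set (EuclideanSpace ℝ (Fin l))),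
    (∀ j, MeasurableSet (A j)) → Pairwise (fun j k => Disjoint (A j) (A k)) →
      iIndepFun (fun j ω => pointCount (fun i => X i ω) (A j)) P

/-- A homogeneous `l`-dimensional shotgun cellular system with base station density `lam`:
base station `i` is at `X i`, has transmission power `K i` and shadow fading factor `Ψ i`; the
pairs `(K i, Ψ i)` are i.i.d. across base stations (`K i` and `Ψ i` may be dependent) and
independent of the base station locations. -/
structure IsHomogeneousSCS {Ω : Type*} [MeasurableSpace Ω] (l : ℕ) (lam : ℝ)
    (X : ℕ → Ω → EuclideanSpace ℝ (Fin l)) (K Ψ : ℕ → Ω → ℝ) (P : Measure Ω) : Prop where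
  poisson : IsHomogeneousPoisson l lam X P
  measurable_power : ∀ i, Measurable (K i)
  measurable_fading : ∀ i, Measurable (Ψ i)
  power_nonneg : ∀ i, ∀ᵐ ω ∂P, 0 ≤ K i ω
  fading_nonneg : ∀ i, ∀ᵐ ω ∂P, 0 ≤ Ψ i ω
  indep_marks : iIndepFun (fun i ω => (K i ω, Ψ i ω)) P
  identDistrib_marks : ∀ i,
    IdentDistrib (fun ω => (K i ω, Ψ i ω)) (fun ω => (K 0 ω, Ψ 0 ω)) P P
  indep_locations : IndepFun (fun ω i => X i ω) (fun ω i => (K i ω, Ψ i ω)) P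

/-- The power `k ψ ‖x‖^(-ε)` received at the origin from a base station at `x` with transmission
power `k` and shadow fading factor `ψ`. -/
def receivedPower {l : ℕ} (ε : ℝ) (x : EuclideanSpace ℝ (Fin l)) (k ψ : ℝ) : ℝ≥0∞ :=
  ENNReal.ofReal (k * ψ) * ‖x‖ₑ ^ (-ε)

/-- Base station `s` has the strongest received power. -/
def IsServing (p : ℕ → ℝ≥0∞) (s : ℕ) : Prop :=
  ∀ i, p i ≤ p s

open Classical in
/-- The carrier-to-interference ratio for the received powers `p`: the power of the serving base
station (a strongest one) divided by the sum of the powers of all other base stations.  If several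
base stations are strongest, the value does not depend on which of them serves; if none is, the
value is `0` by convention.  It is `0` if the interference is infinite and the carrier finite. -/
def carrierToInterference (p : ℕ → ℝ≥0∞) : ℝ≥0∞ :=
  if h : ∃ s, IsServing p s then p h.choose / ∑' i : {i : ℕ // i ≠ h.choose}, p i else 0

/-- The `C/I` at the mobile station at the origin, as a random variable. -/
def cOverI {Ω : Type*} {l : ℕ} (ε : ℝ) (X : ℕ → Ω → EuclideanSpace ℝ (Fin l))
    (K Ψ : ℕ → Ω → ℝ) (ω : Ω) : ℝ≥0∞ :=
  carrierToInterference fun i => receivedPower ε (X i ω) (K i ω) (Ψ i ω)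

end

/-! The received powers form a random configuration on `[0, ∞]`, and its probability generating
functional `w ↦ 𝔼 ∏ (1 - w(pᵢ))` carries the whole argument. For an independently marked Poisson
process it is the exponential of minus `lam ∫ 𝔼 w(KΨ‖x‖^(-ε)) dx`
(`IsHomogeneousPoisson.lintegral_infProd_marked`). The substitution `x ↦ (KΨ)^(-1/ε) x` then pulls
the marks out as the single constant `A = 𝔼[(KΨ)^(l/ε)]`
(`IsHomogeneousSCS.lintegral_infProd_receivedPower`).

Multiplying all powers of the second system by a constant `a` multiplies its `A'` by `a^(l/ε)`.
Since `A` and `A'` lie in `(0, ∞)`, some `a` makes the two functionals equal. The functional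
determines the joint law of the maximum `M` and the sum `S` of the powers
(`identDistrib_iSup_tsum`). Almost surely `C/I = M / (S - M)`, which is unchanged by scaling, so the
two laws agree.

A strongest station exists because, almost surely, only finitely many powers exceed any given
positive level (`IsHomogeneousSCS.ae_finite_le_receivedPower`). -/

/-! ### Exponentials and infinite products on `[0, ∞]` -/

/-- The function `z ↦ e⁻ᶻ` on `[0, ∞]`. -/
noncomputable def negExp (z : ℝ≥0∞) : ℝ≥0∞ := EReal.exp (-(z : EReal))

theorem negExp_ofReal {r : ℝ} (hr : 0 ≤ r) :
    negExp (ENNReal.ofReal r) = ENNReal.ofReal (Real.exp (-r)) := by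
  rw [negExp, EReal.coe_ennreal_ofReal, max_eq_left hr, ← EReal.coe_neg, EReal.exp_coe]

theorem negExp_zero : negExp 0 = 1 := by simp [negExp]

theorem negExp_le_one (z : ℝ≥0∞) : negExp z ≤ 1 := by
  rw [negExp, EReal.exp_le_one_iff, EReal.neg_le_zero]
  exact EReal.coe_ennreal_nonneg z

theorem negExp_strictAnti : StrictAnti negExp := fun a b h => by
  simpa [negExp] using h

theorem continuous_negExp : Continuous negExp :=
  ENNReal.continuous_exp.comp (continuous_neg.comp continuous_coe_ennreal_ereal)

theorem measurable_negExp : Measurable negExp := continuous_negExp.measurable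

theorem negExp_add (a b : ℝ≥0∞) : negExp (a + b) = negExp a * negExp b := by
  rw [negExp, negExp, negExp, ← EReal.exp_add, EReal.coe_ennreal_add, EReal.neg_add, sub_eq_add_neg]
  · exact Or.inl (EReal.coe_ennreal_ne_bot a)
  · exact Or.inr (EReal.coe_ennreal_ne_bot b)

theorem negExp_sum {ι : Type*} (s : Finset ι) (f : ι → ℝ≥0∞) :
    negExp (∑ i ∈ s, f i) = ∏ i ∈ s, negExp (f i) := by
  classical
  induction s using Finset.induction_on with
  | empty => simp [negExp_zero]
  | insert a s ha ih => rw [Finset.sum_insert ha, Finset.prod_insert ha, negExp_add, ih]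

theorem negExp_iSup {ι : Sort*} [Nonempty ι] (f : ι → ℝ≥0∞) :
    negExp (⨆ i, f i) = ⨅ i, negExp (f i) :=
  negExp_strictAnti.antitone.map_ciSup_of_continuousAt continuous_negExp.continuousAt
    (OrderTop.bddAbove _)

/-- The infinite product `∏ i, f i` of numbers `f i ≤ 1`, as the infimum of the partial products. -/
noncomputable def infProd (f : ℕ → ℝ≥0∞) : ℝ≥0∞ := ⨅ n, ∏ i ∈ Finset.range n, f i

theorem antitone_prod_range {f : ℕ → ℝ≥0∞} (hf : ∀ i, f i ≤ 1) :
    Antitone fun n => ∏ i ∈ Finset.range n, f i :=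
  antitone_nat_of_succ_le fun n => by
    rw [Finset.prod_range_succ]
    exact mul_le_of_le_one_right' (hf n)

theorem infProd_le_one (f : ℕ → ℝ≥0∞) : infProd f ≤ 1 :=
  (iInf_le _ 0).trans (by simp)

theorem infProd_mono {f g : ℕ → ℝ≥0∞} (h : ∀ i, f i ≤ g i) : infProd f ≤ infProd g :=
  iInf_mono fun _ => Finset.prod_le_prod' fun i _ => h i

theorem measurable_infProd {Ω : Type*} [MeasurableSpace Ω] {f : ℕ → Ω → ℝ≥0∞}
    (hf : ∀ i, Measurable (f i)) : Measurable fun ω => infProd fun i => f i ω :=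
  Measurable.iInf fun _ => Finset.measurable_fun_prod _ fun i _ => hf i

/-- A product of infima of decreasing sequences bounded by `1` is the infimum of the products. -/
theorem prod_iInf {ι : Type*} (s : Finset ι) {f : ι → ℕ → ℝ≥0∞} (hf : ∀ i, Antitone (f i))
    (h1 : ∀ i k, f i k ≤ 1) : ∏ i ∈ s, ⨅ k, f i k = ⨅ k, ∏ i ∈ s, f i k := by
  have hlim : Filter.Tendsto (fun k => ∏ i ∈ s, f i k) Filter.atTop
      (nhds (∏ i ∈ s, ⨅ k, f i k)) := by
    classical
    induction s using Finset.induction_on with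
    | empty => simp
    | insert a s ha ih =>
      simp only [Finset.prod_insert ha]
      refine ENNReal.Tendsto.mul (tendsto_atTop_iInf (hf a)) (Or.inr ?_) ih (Or.inr ?_)
      · exact ((Finset.prod_le_one' fun i _ => (iInf_le _ 0).trans (h1 i 0)).trans_lt
          ENNReal.one_lt_top).ne
      · exact (((iInf_le _ 0).trans (h1 a 0)).trans_lt ENNReal.one_lt_top).ne
  refine tendsto_nhds_unique hlim (tendsto_atTop_iInf fun k m hkm => ?_)
  exact Finset.prod_le_prod' fun i _ => hf i hkm

theorem infProd_iInf {f : ℕ → ℕ → ℝ≥0∞} (hf : ∀ i, Antitone (f i)) (h1 : ∀ i k, f i k ≤ 1) :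
    infProd (fun i => ⨅ k, f i k) = ⨅ k, infProd fun i => f i k := by
  simp only [infProd, prod_iInf _ hf h1]
  exact iInf_comm

theorem infProd_prod {ι : Type*} (s : Finset ι) {f : ι → ℕ → ℝ≥0∞} (h1 : ∀ j i, f j i ≤ 1) :
    infProd (fun i => ∏ j ∈ s, f j i) = ∏ j ∈ s, infProd (f j) := by
  simp only [infProd]
  rw [prod_iInf s (fun j => antitone_prod_range (h1 j))
    (fun j k => Finset.prod_le_one' fun i _ => h1 j i)]
  exact iInf_congr fun n => Finset.prod_comm

theorem infProd_mul {f g : ℕ → ℝ≥0∞} (hf : ∀ i, f i ≤ 1) (hg : ∀ i, g i ≤ 1) :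
    infProd (fun i => f i * g i) = infProd f * infProd g := by
  have := infProd_prod (Finset.univ : Finset Bool) (f := fun b => if b then f else g)
    (by intro j i; cases j <;> simp [hf, hg])
  simpa using this

theorem infProd_pow {f : ℕ → ℝ≥0∞} (hf : ∀ i, f i ≤ 1) (n : ℕ) :
    infProd (fun i => f i ^ n) = infProd f ^ n := by
  simpa using infProd_prod (Finset.range n) (f := fun _ => f) (fun _ => hf)

theorem infProd_negExp (p : ℕ → ℝ≥0∞) : infProd (fun i => negExp (p i)) = negExp (∑' i, p i) := by
  rw [ENNReal.tsum_eq_iSup_nat, negExp_iSup]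
  simp only [infProd, negExp_sum]

/-! ### Counts with values in `ℕ ∪ {∞}` and their generating functions -/

/-- The power `c ^ N` with an exponent in `ℕ ∪ {∞}`, for `c ≤ 1`. -/
noncomputable def enatPow (c : ℝ≥0∞) (N : ℕ∞) : ℝ≥0∞ := ⨅ (n : ℕ) (_ : (n : ℕ∞) ≤ N), c ^ n

theorem enatPow_natCast {c : ℝ≥0∞} (hc : c ≤ 1) (n : ℕ) : enatPow c n = c ^ n := by
  refine le_antisymm (iInf₂_le (f := fun k (_ : ((k : ℕ) : ℕ∞) ≤ n) => c ^ k) n le_rfl) (le_iInf₂ fun k hk => ?_)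
  exact pow_le_pow_right_of_le_one' hc (by exact_mod_cast hk)

/-- The `k`-th partial product is `c` to the number of hits among the first `k` indices, and any
finite set of hits lies in some initial segment. -/
theorem infProd_ite {E : Type*} (x : ℕ → E) (A : Set E) [DecidablePred (· ∈ A)] {c : ℝ≥0∞} (hc : c ≤ 1) :
    infProd (fun i => if x i ∈ A then c else 1) = enatPow c (pointCount x A) := by
  have hprod : ∀ k, (∏ i ∈ Finset.range k, if x i ∈ A then c else 1)
      = c ^ ((Finset.range k).filter fun i => x i ∈ A).card := fun k => by
    rw [Finset.prod_ite]; simp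
  refine le_antisymm (le_iInf₂ fun n hn => ?_) (le_iInf fun k => ?_)
  · obtain ⟨s, hs, hcard⟩ := Set.exists_subset_encard_eq hn
    have hfin : s.Finite := Set.finite_of_encard_eq_coe hcard
    obtain ⟨k, hk⟩ := hfin.toFinset.exists_nat_subset_range
    refine (iInf_le _ k).trans ?_
    rw [hprod]
    refine pow_le_pow_right_of_le_one' hc ?_
    have : hfin.toFinset.card = n := by
      rw [hfin.encard_eq_coe_toFinset_card] at hcard
      exact_mod_cast hcard
    rw [← this]
    refine Finset.card_le_card fun i hi => ?_
    rw [Finset.mem_filter]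
    exact ⟨hk hi, hs (hfin.mem_toFinset.1 hi)⟩
  · rw [hprod]
    refine iInf₂_le (f := fun k _ => c ^ k) _ ?_
    rw [← Set.encard_coe_eq_coe_finsetCard]
    refine Set.encard_le_encard fun i hi => ?_
    simpa using (Finset.mem_filter.1 (Finset.mem_coe.1 hi)).2

theorem tsum_poissonMeasure_mul_pow (r : ℝ≥0) {c : ℝ≥0∞} (hc : c ≤ 1) :
    ∑' n : ℕ, poissonMeasure r {n} * c ^ n = negExp (r * (1 - c)) := by
  have hc' : c ≠ ∞ := (hc.trans_lt ENNReal.one_lt_top).ne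
  lift c to ℝ≥0 using hc'
  have hc1 : c ≤ 1 := by exact_mod_cast hc
  have h1 : (r : ℝ≥0∞) * (1 - c) = ENNReal.ofReal ((r : ℝ) * (1 - c)) := by
    rw [ENNReal.ofReal_mul r.coe_nonneg, ENNReal.ofReal_coe_nnreal, ENNReal.ofReal_sub _ c.coe_nonneg]
    simp
  rw [h1, negExp_ofReal (mul_nonneg r.coe_nonneg (sub_nonneg.2 (by exact_mod_cast hc1)))]
  have hs : HasSum (fun n : ℕ => Real.exp (-r) * r ^ n / n.factorial * (c : ℝ) ^ n)
      (Real.exp (-(r * (1 - c)))) := by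
    have := (NormedSpace.expSeries_div_hasSum_exp ((r : ℝ) * c)).mul_left (Real.exp (-r))
    rw [← Real.exp_eq_exp_ℝ, ← Real.exp_add] at this
    have hfun : (fun n : ℕ => Real.exp (-r) * r ^ n / n.factorial * (c : ℝ) ^ n)
        = fun n : ℕ => Real.exp (-r) * (((r : ℝ) * c) ^ n / n.factorial) := by
      ext n; rw [mul_pow]; ring
    rw [hfun, show -((r : ℝ) * (1 - c)) = -r + r * c by ring]
    exact this
  rw [← hs.tsum_eq, ENNReal.ofReal_tsum_of_nonneg (fun n => by positivity) hs.summable]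
  congr 1; ext n
  rw [poissonMeasure_singleton, ENNReal.ofReal_mul (by positivity), ENNReal.ofReal_pow c.coe_nonneg,
    ENNReal.ofReal_coe_nnreal]

theorem measurable_pointCount {Ω E : Type*} [MeasurableSpace Ω] [MeasurableSpace E]
    {X : ℕ → Ω → E} (hX : ∀ i, Measurable (X i)) {A : Set E} (hA : MeasurableSet A) :
    Measurable fun ω => pointCount (fun i => X i ω) A := by
  have hge : ∀ n : ℕ, MeasurableSet {ω | (n : ℕ∞) ≤ pointCount (fun i => X i ω) A} := fun n => by
    -- At least `n` hits means that some `n`-element index set consists of hits; there are countably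
    -- many such sets.
    have : {ω | (n : ℕ∞) ≤ pointCount (fun i => X i ω) A}
        = ⋃ s : {s : Finset ℕ // s.card = n}, ⋂ i ∈ s.1, X i ⁻¹' A := by
      ext ω
      simp only [Set.mem_ofPred_eq, Set.mem_iUnion, Set.mem_iInter, Set.mem_preimage]
      constructor
      · intro h
        obtain ⟨s, hs, hcard⟩ := Set.exists_subset_encard_eq h
        have hfin : s.Finite := Set.finite_of_encard_eq_coe hcard
        refine ⟨⟨hfin.toFinset, ?_⟩, fun i hi => hs (hfin.mem_toFinset.1 hi)⟩
        rw [hfin.encard_eq_coe_toFinset_card] at hcard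
        exact_mod_cast hcard
      · rintro ⟨⟨s, rfl⟩, h⟩
        rw [← Set.encard_coe_eq_coe_finsetCard]
        exact Set.encard_le_encard fun i hi => h i hi
    rw [this]
    exact MeasurableSet.iUnion fun s => s.1.measurableSet_biInter fun i _ => hX i hA
  rw [ENat.measurable_iff]
  intro n
  have : (fun ω => pointCount (fun i => X i ω) A) ⁻¹' {(n : ℕ∞)}
      = {ω | (n : ℕ∞) ≤ pointCount (fun i => X i ω) A} \
        {ω | ((n + 1 : ℕ) : ℕ∞) ≤ pointCount (fun i => X i ω) A} := by
    ext ω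
    simp only [Set.mem_preimage, Set.mem_singleton_iff, Set.mem_sdiff, Set.mem_ofPred_eq, not_le]
    generalize pointCount (fun i => X i ω) A = N
    cases N with
    | top => simp
    | coe N => norm_cast; omega
  rw [this]
  exact (hge n).diff (hge (n + 1))

/-- Integration against an `ℕ ∪ {∞}`-valued random variable with the law of a probability measure
on `ℕ`. -/
theorem lintegral_enat {Ω : Type*} [MeasurableSpace Ω] {P : Measure Ω} [IsProbabilityMeasure P]
    {N : Ω → ℕ∞} (hN : Measurable N) {μ : Measure ℕ} [IsProbabilityMeasure μ]
    (h : ∀ n : ℕ, P {ω | N ω = n} = μ {n}) (f : ℕ∞ → ℝ≥0∞) :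
    ∫⁻ ω, f (N ω) ∂P = ∑' n : ℕ, μ {n} * f n := by
  have hmap : P.map N = μ.map (Nat.cast : ℕ → ℕ∞) := by
    have hcast : Measurable (Nat.cast : ℕ → ℕ∞) := measurable_from_top
    have : IsProbabilityMeasure (P.map N) := Measure.isProbabilityMeasure_map hN.aemeasurable
    have : IsProbabilityMeasure (μ.map (Nat.cast : ℕ → ℕ∞)) :=
      Measure.isProbabilityMeasure_map hcast.aemeasurable
    have hnat : ∀ n : ℕ, P.map N {(n : ℕ∞)} = μ.map (Nat.cast : ℕ → ℕ∞) {(n : ℕ∞)} := fun n => by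
      rw [Measure.map_apply hN (measurableSet_singleton _),
        Measure.map_apply hcast (measurableSet_singleton _)]
      have h2 : (Nat.cast : ℕ → ℕ∞) ⁻¹' {(n : ℕ∞)} = {n} := by ext; simp
      rw [h2, ← h n]; rfl
    have hdisj : Pairwise (Function.onFun Disjoint fun n : ℕ => ({(n : ℕ∞)} : Set ℕ∞)) :=
      fun a b hab => by simpa [Function.onFun] using hab
    refine Measure.ext_of_singleton fun k => ?_
    cases k with
    | coe n => exact hnat n
    | top =>
      -- Nothing is assumed about the mass at `⊤`: it is what the finite values leave out of total
      -- mass `1`.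
      have htop : ({⊤} : Set ℕ∞) = (⋃ n : ℕ, {(n : ℕ∞)})ᶜ := by
        ext k; cases k <;> simp
      rw [htop, prob_compl_eq_one_sub (MeasurableSet.of_discrete),
        prob_compl_eq_one_sub (MeasurableSet.of_discrete),
        measure_iUnion hdisj fun _ => measurableSet_singleton _,
        measure_iUnion hdisj fun _ => measurableSet_singleton _]
      simp only [hnat]
  have hf : Measurable f := measurable_from_top
  rw [← lintegral_map hf hN, hmap, lintegral_map hf measurable_from_top, lintegral_countable']
  simp only [mul_comm]

/-! ### Generating functional of a Poisson process -/

section PoissonProcess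

variable {Ω : Type*} [MeasurableSpace Ω] {P : Measure Ω} [IsProbabilityMeasure P] {l : ℕ}
  {lam : ℝ} {X : ℕ → Ω → EuclideanSpace ℝ (Fin l)}

theorem IsHomogeneousPoisson.lintegral_enatPow (h : IsHomogeneousPoisson l lam X P)
    {A : Set (EuclideanSpace ℝ (Fin l))} (hA : MeasurableSet A) (hv : volume A ≠ ∞)
    {c : ℝ≥0∞} (hc : c ≤ 1) :
    ∫⁻ ω, enatPow c (pointCount (fun i => X i ω) A) ∂P
      = negExp (ENNReal.ofReal lam * (volume A * (1 - c))) := by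
  rw [lintegral_enat (measurable_pointCount h.measurable hA) (h.poisson A hA hv)]
  simp only [enatPow_natCast hc]
  rw [tsum_poissonMeasure_mul_pow _ hc, ENNReal.coe_mul, ENNReal.coe_toNNReal hv, mul_assoc]
  rfl

open Classical in
-- The product over points regroups into one power per set, and counts in disjoint sets are
-- independent.
theorem IsHomogeneousPoisson.lintegral_infProd_of_disjoint (h : IsHomogeneousPoisson l lam X P)
    {m : ℕ} {A : Fin m → Set (EuclideanSpace ℝ (Fin l))} (hA : ∀ j, MeasurableSet (A j))
    (hv : ∀ j, volume (A j) ≠ ∞) (hd : Pairwise fun j k => Disjoint (A j) (A k))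
    {c : Fin m → ℝ≥0∞} (hc : ∀ j, c j ≤ 1) :
    ∫⁻ ω, infProd (fun i => ∏ j, if X i ω ∈ A j then c j else 1) ∂P
      = negExp (ENNReal.ofReal lam * ∑ j, volume (A j) * (1 - c j)) := by
  have h1 : ∀ ω, infProd (fun i => ∏ j, if X i ω ∈ A j then c j else 1)
      = ∏ j, enatPow (c j) (pointCount (fun i => X i ω) (A j)) := fun ω => by
    rw [infProd_prod Finset.univ (f := fun j i => if X i ω ∈ A j then c j else 1)]
    · exact Finset.prod_congr rfl fun j _ => infProd_ite (fun i => X i ω) (A j) (hc j)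
    · intro j i; split_ifs; exacts [hc j, le_rfl]
  simp only [h1]
  have hmeas : ∀ j, Measurable (enatPow (c j)) := fun j => measurable_from_top
  rw [lintegral_prod_eq_prod_lintegral_of_indepFun Finset.univ
    (fun j ω => enatPow (c j) (pointCount (fun i => X i ω) (A j)))
    ((h.indep m A hA hd).comp (fun j => enatPow (c j)) hmeas)
    (fun j => (hmeas j).comp (measurable_pointCount h.measurable (hA j)))]
  rw [Finset.mul_sum, negExp_sum]
  exact Finset.prod_congr rfl fun j _ => h.lintegral_enatPow (hA j) (hv j) (hc j)

theorem IsHomogeneousPoisson.lintegral_infProd_simpleFunc (h : IsHomogeneousPoisson l lam X P)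
    (g : SimpleFunc (EuclideanSpace ℝ (Fin l)) ℝ≥0∞) (hg : ∀ x, g x ≤ 1)
    (hv : volume (Function.support g) ≠ ∞) :
    ∫⁻ ω, infProd (fun i => 1 - g (X i ω)) ∂P
      = negExp (ENNReal.ofReal lam * ∫⁻ x, g x) := by
  classical
  -- The value `0` is left out: it contributes only factors `1`, and its level set may have infinite
  -- volume.
  set s : Finset ℝ≥0∞ := g.range.filter (· ≠ 0) with hs
  let e : s ≃ Fin s.card := s.equivFin
  have hprod : ∀ x, 1 - g x = ∏ j, if x ∈ g ⁻¹' {((e.symm j : s) : ℝ≥0∞)} then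
      1 - ((e.symm j : s) : ℝ≥0∞) else 1 := fun x => by
    rw [Equiv.prod_comp e.symm fun a : s => if x ∈ g ⁻¹' {(a : ℝ≥0∞)} then 1 - (a : ℝ≥0∞) else 1,
      Finset.prod_coe_sort s fun a => if x ∈ g ⁻¹' {a} then 1 - a else 1]
    simp only [Set.mem_preimage, Set.mem_singleton_iff, Finset.prod_ite_eq]
    split_ifs with hx
    · rfl
    · have : g x = 0 := by
        by_contra h0
        exact hx (Finset.mem_filter.2 ⟨g.mem_range_self x, h0⟩)
      simp [this]
  have hle : ∀ a ∈ s, a ≤ 1 := fun a ha => by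
    obtain ⟨x, rfl⟩ := SimpleFunc.mem_range.1 (Finset.mem_filter.1 ha).1
    exact hg x
  have hne : ∀ a ∈ s, a ≠ 0 := fun a ha => (Finset.mem_filter.1 ha).2
  simp only [hprod]
  rw [h.lintegral_infProd_of_disjoint (fun j => g.measurableSet_fiber _)
    (fun j => ?_) (fun j k hjk => ?_) (fun j => tsub_le_self)]
  · congr 2
    rw [Equiv.sum_comp e.symm fun a : s => volume (g ⁻¹' {(a : ℝ≥0∞)}) * (1 - (1 - (a : ℝ≥0∞))),
      Finset.sum_coe_sort s fun a => volume (g ⁻¹' {a}) * (1 - (1 - a)),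
      SimpleFunc.lintegral_eq_lintegral, SimpleFunc.lintegral, hs, Finset.sum_filter]
    refine Finset.sum_congr rfl fun a ha => ?_
    split_ifs with h0
    · rw [ENNReal.sub_sub_cancel ENNReal.one_ne_top (hle a (Finset.mem_filter.2 ⟨ha, h0⟩)), mul_comm]
    · simp [not_not.1 h0]
  · refine ne_top_of_le_ne_top hv (measure_mono fun x hx => ?_)
    rw [Function.mem_support, Set.mem_singleton_iff.1 hx]
    exact hne _ (e.symm j).2
  · refine Disjoint.preimage _ (Set.disjoint_singleton.2 fun h' => hjk ?_)
    exact e.symm.injective (Subtype.ext h')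

/-- The probability generating functional of a homogeneous Poisson point process. -/
theorem IsHomogeneousPoisson.lintegral_infProd (h : IsHomogeneousPoisson l lam X P)
    {w : EuclideanSpace ℝ (Fin l) → ℝ≥0∞} (hw : Measurable w) (hw1 : ∀ x, w x ≤ 1) :
    ∫⁻ ω, infProd (fun i => 1 - w (X i ω)) ∂P = negExp (ENNReal.ofReal lam * ∫⁻ x, w x) := by
  -- Cutting off to balls gives supports of finite volume, while the approximations still increase
  -- to `w`.
  let g : ℕ → SimpleFunc (EuclideanSpace ℝ (Fin l)) ℝ≥0∞ := fun k =>
    (SimpleFunc.eapprox w k).restrict (Metric.ball 0 k)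
  have happ : ∀ k x, g k x = (Metric.ball (0 : EuclideanSpace ℝ (Fin l)) k).indicator
      (SimpleFunc.eapprox w k) x := fun k x => by
    rw [SimpleFunc.restrict_apply _ measurableSet_ball]
  have hmono : Monotone fun k => (g k : EuclideanSpace ℝ (Fin l) → ℝ≥0∞) := fun k m hkm x => by
    simp only [happ]
    exact (Set.indicator_le_indicator (SimpleFunc.monotone_eapprox w hkm x)).trans
      (Set.indicator_le_indicator_apply_of_subset
        (Metric.ball_subset_ball (by exact_mod_cast hkm)) zero_le)
  have hsup : ∀ x, ⨆ k, g k x = w x := fun x => by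
    refine le_antisymm (iSup_le fun k => ?_) ?_
    · rw [happ]
      exact (Set.indicator_le_self _ _ _).trans
        ((le_iSup (fun k => SimpleFunc.eapprox w k x) k).trans
          (SimpleFunc.iSup_eapprox_apply hw x).le)
    · rw [← SimpleFunc.iSup_eapprox_apply hw x]
      refine iSup_le fun k => ?_
      obtain ⟨m, hm⟩ := exists_nat_gt ‖x‖
      refine le_trans ?_ (le_iSup _ (max k m))
      rw [happ, Set.indicator_of_mem]
      · exact SimpleFunc.monotone_eapprox w (le_max_left k m) x
      · rw [mem_ball_zero_iff]
        exact hm.trans_le (by exact_mod_cast le_max_right k m)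
  have hg1 : ∀ k x, g k x ≤ 1 := fun k x =>
    (le_iSup (fun k => g k x) k).trans ((hsup x).le.trans (hw1 x))
  have hinf : ∀ x, 1 - w x = ⨅ k, (1 - g k x) := fun x => by
    rw [← hsup x, ENNReal.sub_iSup ENNReal.one_ne_top]
  have hanti : ∀ x, Antitone fun k => 1 - g k x := fun x k m hkm =>
    tsub_le_tsub_left (hmono hkm x) 1
  simp only [hinf]
  have h1 : ∀ ω, infProd (fun i => ⨅ k, (1 - g k (X i ω)))
      = ⨅ k, infProd fun i => 1 - g k (X i ω) := fun ω =>
    infProd_iInf (fun i => hanti (X i ω)) fun i k => tsub_le_self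
  simp only [h1]
  rw [lintegral_iInf]
  · have h2 : ∀ k, ∫⁻ ω, infProd (fun i => 1 - g k (X i ω)) ∂P
        = negExp (ENNReal.ofReal lam * ∫⁻ x, g k x) := fun k => by
      refine h.lintegral_infProd_simpleFunc (g k) (hg1 k) ?_
      refine ne_top_of_le_ne_top (measure_ball_lt_top (x := 0) (r := (k : ℝ))).ne
        (measure_mono fun x hx => ?_)
      rw [Function.mem_support, happ] at hx
      exact Set.mem_of_indicator_ne_zero hx
    simp only [h2]
    rw [← negExp_iSup, ← ENNReal.mul_iSup, ← lintegral_iSup (fun k => (g k).measurable) hmono]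
    simp only [hsup]
  · exact fun k => measurable_infProd fun i =>
      measurable_const.sub ((g k).measurable.comp (h.measurable i))
  · exact fun k m hkm ω => infProd_mono fun i => hanti _ hkm
  · refine ne_top_of_le_ne_top ENNReal.one_ne_top ?_
    refine (lintegral_mono fun ω => infProd_le_one _).trans ?_
    simp

end PoissonProcess

/-! ### Independent marking -/

theorem ProbabilityTheory.IndepFun.lintegral_comp_eq {Ω α β : Type*} [MeasurableSpace Ω]
    [MeasurableSpace α] [MeasurableSpace β] {P : Measure Ω} [IsProbabilityMeasure P]
    {A : Ω → α} {B : Ω → β} (hAB : IndepFun A B P) (hA : Measurable A) (hB : Measurable B)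
    {F : α → β → ℝ≥0∞} (hF : Measurable (Function.uncurry F)) :
    ∫⁻ ω, F (A ω) (B ω) ∂P = ∫⁻ ω, ∫⁻ ω', F (A ω) (B ω') ∂P ∂P := by
  have h1 : ∫⁻ ω, F (A ω) (B ω) ∂P
      = ∫⁻ z, Function.uncurry F z ∂(P.map fun ω => (A ω, B ω)) := by
    rw [lintegral_map hF (hA.prodMk hB)]; rfl
  have := Measure.isProbabilityMeasure_map (μ := P) hA.aemeasurable
  have := Measure.isProbabilityMeasure_map (μ := P) hB.aemeasurable
  rw [h1, (indepFun_iff_map_prod_eq_prod_map_map hA.aemeasurable hB.aemeasurable).1 hAB,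
    lintegral_prod _ hF.aemeasurable, lintegral_map hF.lintegral_prod_right' hA]
  refine lintegral_congr fun ω => ?_
  exact lintegral_map (f := fun y => Function.uncurry F (A ω, y)) (hF.comp measurable_prodMk_left) hB

section MarkedPoissonProcess

variable {Ω : Type*} [MeasurableSpace Ω] {P : Measure Ω} [IsProbabilityMeasure P] {l : ℕ}
  {lam : ℝ} {X : ℕ → Ω → EuclideanSpace ℝ (Fin l)} {S : Type*} [MeasurableSpace S]
  {M : ℕ → Ω → S}

/-- The probability generating functional of an independently marked homogeneous Poisson point
process. -/
theorem IsHomogeneousPoisson.lintegral_infProd_marked (h : IsHomogeneousPoisson l lam X P)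
    (hM : ∀ i, Measurable (M i)) (hind : iIndepFun M P)
    (hid : ∀ i, IdentDistrib (M i) (M 0) P P)
    (hXM : IndepFun (fun ω i => X i ω) (fun ω i => M i ω) P)
    {w : EuclideanSpace ℝ (Fin l) → S → ℝ≥0∞} (hw : Measurable (Function.uncurry w))
    (hw1 : ∀ x m, w x m ≤ 1) :
    ∫⁻ ω, infProd (fun i => 1 - w (X i ω) (M i ω)) ∂P
      = negExp (ENNReal.ofReal lam * ∫⁻ x, ∫⁻ ω, w x (M 0 ω) ∂P) := by
  have hw2 : ∀ x, Measurable (w x) := fun x => hw.comp measurable_prodMk_left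
  have hwbar : Measurable fun x => ∫⁻ ω, w x (M 0 ω) ∂P := by
    refine Measurable.lintegral_prod_right' (f := fun z : _ × Ω => w z.1 (M 0 z.2)) ?_
    exact hw.comp (measurable_fst.prodMk ((hM 0).comp measurable_snd))
  have hwbar1 : ∀ x, ∫⁻ ω, w x (M 0 ω) ∂P ≤ 1 := fun x =>
    (lintegral_mono fun ω => hw1 x (M 0 ω)).trans (by simp)
  rw [← h.lintegral_infProd hwbar hwbar1]
  have hXmeas : Measurable fun ω i => X i ω := measurable_pi_lambda _ h.measurable
  have hMmeas : Measurable fun ω i => M i ω := measurable_pi_lambda _ hM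
  -- With the locations frozen, independence of the marks factors the finite product. Each mark can
  -- then be averaged out, leaving the unmarked functional of the averaged weight.
  have hfin : ∀ n, ∫⁻ ω, ∏ i ∈ Finset.range n, (1 - w (X i ω) (M i ω)) ∂P
      = ∫⁻ ω, ∏ i ∈ Finset.range n, (1 - ∫⁻ ω', w (X i ω) (M 0 ω') ∂P) ∂P := fun n => by
    rw [hXM.lintegral_comp_eq hXmeas hMmeas
      (F := fun x m => ∏ i ∈ Finset.range n, (1 - w (x i) (m i)))]
    · refine lintegral_congr fun ω => ?_
      rw [lintegral_prod_eq_prod_lintegral_of_indepFun (Finset.range n)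
        (fun i ω' => 1 - w (X i ω) (M i ω'))
        (hind.comp (fun i m => 1 - w (X i ω) m) fun i => measurable_const.sub (hw2 _))
        (fun i => (measurable_const.sub (hw2 _)).comp (hM i))]
      refine Finset.prod_congr rfl fun i _ => ?_
      have h0 : ∫⁻ ω', (1 - w (X i ω) (M i ω')) ∂P = ∫⁻ ω', (1 - w (X i ω) (M 0 ω')) ∂P :=
        ((hid i).comp (u := fun m => 1 - w (X i ω) m)
          (measurable_const.sub (hw2 _))).lintegral_eq
      rw [h0, lintegral_sub (g := fun ω' => w (X i ω) (M 0 ω')) ((hw2 _).comp (hM 0))]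
      · simp
      · exact ne_top_of_le_ne_top ENNReal.one_ne_top (hwbar1 _)
      · exact Filter.Eventually.of_forall fun ω' => hw1 _ _
    · refine Finset.measurable_fun_prod _ fun i _ => measurable_const.sub ?_
      have hpair : Measurable fun z : (ℕ → EuclideanSpace ℝ (Fin l)) × (ℕ → S) => (z.1 i, z.2 i) :=
        ((measurable_pi_apply i).comp measurable_fst).prodMk
          ((measurable_pi_apply i).comp measurable_snd)
      exact hw.comp hpair
  have hlim : ∀ f : ℕ → Ω → ℝ≥0∞, (∀ i, Measurable (f i)) → (∀ i ω, f i ω ≤ 1) →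
      ∫⁻ ω, infProd (fun i => f i ω) ∂P = ⨅ n, ∫⁻ ω, ∏ i ∈ Finset.range n, f i ω ∂P := by
    intro f hf hf1
    refine lintegral_iInf (fun n => Finset.measurable_fun_prod _ fun i _ => hf i)
      (fun n m hnm ω => antitone_prod_range (fun i => hf1 i ω) hnm) (by simp)
  rw [hlim, hlim]
  · exact iInf_congr hfin
  · exact fun i => measurable_const.sub (hwbar.comp (h.measurable i))
  · exact fun i ω => tsub_le_self
  · exact fun i => measurable_const.sub (hw.comp ((h.measurable i).prodMk (hM i)))
  · exact fun i ω => tsub_le_self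

end MarkedPoissonProcess

/-! ### Scaling and the generating functional of the received powers -/

/-- With `r = m^(-1/ε)` one has `m‖x‖^(-ε) = ‖r x‖^(-ε)`, and the change of variables contributes
`r^(-l) = m^(l/ε)`. The condition `w 0 = 0` covers `m = 0`. -/
theorem lintegral_comp_mul_enorm_rpow {l : ℕ} (hl : 1 ≤ l) {ε : ℝ} (hε : 0 < ε) {w : ℝ≥0∞ → ℝ≥0∞}
    (hw : Measurable w) (hw0 : w 0 = 0) {m : ℝ≥0∞} (hm : m ≠ ∞) :
    ∫⁻ x : EuclideanSpace ℝ (Fin l), w (m * ‖x‖ₑ ^ (-ε))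
      = m ^ ((l : ℝ) / ε) * ∫⁻ x : EuclideanSpace ℝ (Fin l), w (‖x‖ₑ ^ (-ε)) := by
  have hlε : 0 < (l : ℝ) / ε := div_pos (by exact_mod_cast hl) hε
  rcases eq_or_ne m 0 with rfl | hm0
  · simp [hw0, ENNReal.zero_rpow_of_pos hlε]
  have hmr : 0 < m.toReal := ENNReal.toReal_pos hm0 hm
  set r : ℝ := m.toReal ^ (-(1 / ε)) with hr
  have hr0 : 0 < r := Real.rpow_pos_of_pos hmr _
  have hrm : ENNReal.ofReal r = m ^ (-(1 / ε)) := by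
    rw [hr, ← ENNReal.ofReal_rpow_of_pos hmr, ENNReal.ofReal_toReal hm]
  have hpt : ∀ x : EuclideanSpace ℝ (Fin l), m * ‖x‖ₑ ^ (-ε) = ‖r • x‖ₑ ^ (-ε) := fun x => by
    have hne : ENNReal.ofReal r ^ ε ≠ 0 := by simp [hr0.not_ge, ENNReal.rpow_eq_zero_iff]
    have hnt : ENNReal.ofReal r ^ ε ≠ ∞ := ENNReal.rpow_ne_top_of_nonneg hε.le ENNReal.ofReal_ne_top
    rw [enorm_smul, Real.enorm_of_nonneg hr0.le, ENNReal.rpow_neg (_ * _),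
      ENNReal.mul_rpow_of_nonneg _ _ hε.le, ENNReal.mul_inv (Or.inl hne) (Or.inl hnt),
      ← ENNReal.rpow_neg, ← ENNReal.rpow_neg, hrm, ← ENNReal.rpow_mul]
    have : -(1 / ε) * -ε = 1 := by field_simp
    rw [this, ENNReal.rpow_one]
  simp only [hpt]
  have hmeas : Measurable fun x : EuclideanSpace ℝ (Fin l) => w (‖x‖ₑ ^ (-ε)) :=
    hw.comp (measurable_enorm.pow_const _)
  rw [← lintegral_map (μ := volume) (f := fun x : EuclideanSpace ℝ (Fin l) => w (‖x‖ₑ ^ (-ε))) hmeas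
    (measurable_const_smul r), Measure.map_addHaar_smul _ hr0.ne', lintegral_smul_measure,
    finrank_euclideanSpace_fin, smul_eq_mul]
  congr 1
  rw [abs_of_pos (by positivity), ENNReal.ofReal_inv_of_pos (by positivity),
    ENNReal.ofReal_pow hr0.le, hrm, ← ENNReal.rpow_natCast, ← ENNReal.rpow_neg, ← ENNReal.rpow_mul]
  congr 1
  field_simp

section SCS

variable {Ω : Type*} [MeasurableSpace Ω] {P : Measure Ω} {l : ℕ}
  {lam : ℝ} {X : ℕ → Ω → EuclideanSpace ℝ (Fin l)} {K Ψ : ℕ → Ω → ℝ}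

theorem measurable_receivedPower (l : ℕ) (ε : ℝ) :
    Measurable fun z : EuclideanSpace ℝ (Fin l) × ℝ × ℝ => receivedPower ε z.1 z.2.1 z.2.2 := by
  unfold receivedPower
  fun_prop

theorem IsHomogeneousSCS.measurable_receivedPower (h : IsHomogeneousSCS l lam X K Ψ P) (ε : ℝ)
    (i : ℕ) : Measurable fun ω => receivedPower ε (X i ω) (K i ω) (Ψ i ω) :=
  (_root_.measurable_receivedPower l ε).comp ((h.poisson.measurable i).prodMk
    ((h.measurable_power i).prodMk (h.measurable_fading i)))

/-- The probability generating functional of the received powers: it depends on the marks only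
through `𝔼[(K Ψ) ^ (l / ε)]`. -/
theorem IsHomogeneousSCS.lintegral_infProd_receivedPower [IsProbabilityMeasure P]
    (h : IsHomogeneousSCS l lam X K Ψ P)
    (hl : 1 ≤ l) {ε : ℝ} (hε : 0 < ε) {w : ℝ≥0∞ → ℝ≥0∞} (hw : Measurable w)
    (hw1 : ∀ p, w p ≤ 1) (hw0 : w 0 = 0) :
    ∫⁻ ω, infProd (fun i => 1 - w (receivedPower ε (X i ω) (K i ω) (Ψ i ω))) ∂P
      = negExp (ENNReal.ofReal lam *
        ((∫⁻ ω, ENNReal.ofReal (K 0 ω * Ψ 0 ω) ^ ((l : ℝ) / ε) ∂P) *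
          ∫⁻ x : EuclideanSpace ℝ (Fin l), w (‖x‖ₑ ^ (-ε)))) := by
  have hmarks : ∀ i, Measurable fun ω => (K i ω, Ψ i ω) := fun i =>
    (h.measurable_power i).prodMk (h.measurable_fading i)
  have hmeas : Measurable (Function.uncurry
      fun (x : EuclideanSpace ℝ (Fin l)) (m : ℝ × ℝ) => w (receivedPower ε x m.1 m.2)) :=
    hw.comp (_root_.measurable_receivedPower l ε)
  rw [h.poisson.lintegral_infProd_marked hmarks h.indep_marks h.identDistrib_marks
    h.indep_locations hmeas fun x m => hw1 _, lintegral_lintegral_swap]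
  · congr 2
    have hm : Measurable fun ω => K 0 ω * Ψ 0 ω := (h.measurable_power 0).mul (h.measurable_fading 0)
    rw [← lintegral_mul_const _ (hm.ennreal_ofReal.pow_const _)]
    refine lintegral_congr fun ω => ?_
    exact lintegral_comp_mul_enorm_rpow hl hε hw hw0 ENNReal.ofReal_ne_top
  · exact (hmeas.comp (measurable_fst.prodMk ((hmarks 0).comp measurable_snd))).aemeasurable

end SCS

/-! ### From the generating functional to the joint law of maximum and sum -/

/-- Finite measures on `[0, 1]` are determined by their moments. -/
theorem MeasureTheory.Measure.ext_of_moments_unitInterval {μ ν : Measure unitInterval}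
    [IsFiniteMeasure μ] [IsFiniteMeasure ν]
    (h : ∀ n : ℕ, ∫ x, (x : ℝ) ^ n ∂μ = ∫ x, (x : ℝ) ^ n ∂ν) : μ = ν := by
  have hcont : ∀ ρ : Measure unitInterval, IsFiniteMeasure ρ →
      Continuous fun f : C(unitInterval, ℝ) => ∫ x, f x ∂ρ := fun ρ hρ => by
    have h1 := (continuous_integral (μ := ρ) (G := ℝ)).comp
      (ContinuousMap.toLp (E := ℝ) 1 ρ ℝ).continuous
    refine h1.congr fun f => ?_
    exact integral_congr_ae (ContinuousMap.coeFn_toLp ρ f)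
  have hint : ∀ ρ : Measure unitInterval, IsFiniteMeasure ρ → ∀ f : C(unitInterval, ℝ),
      Integrable f ρ := fun ρ hρ f =>
    (BoundedContinuousFunction.mkOfCompact f).integrable ρ
  -- Weierstrass: the continuous functions with equal integrals form a closed set containing all
  -- polynomials.
  have hclosed : IsClosed {f : C(unitInterval, ℝ) | ∫ x, f x ∂μ = ∫ x, f x ∂ν} :=
    isClosed_eq (hcont μ inferInstance) (hcont ν inferInstance)
  have hpoly : ∀ q : Polynomial ℝ,
      ∫ x : unitInterval, q.eval (x : ℝ) ∂μ = ∫ x : unitInterval, q.eval (x : ℝ) ∂ν := fun q => by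
    have hint' : ∀ ρ : Measure unitInterval, IsFiniteMeasure ρ → ∀ r : Polynomial ℝ,
        Integrable (fun x : unitInterval => r.eval (x : ℝ)) ρ := fun ρ hρ r =>
      hint ρ hρ ⟨fun x => r.eval (x : ℝ), r.continuous.comp continuous_subtype_val⟩
    induction q using Polynomial.induction_on' with
    | add a b ha hb =>
      simp only [Polynomial.eval_add]
      rw [integral_add (hint' μ inferInstance a) (hint' μ inferInstance b),
        integral_add (hint' ν inferInstance a) (hint' ν inferInstance b), ha, hb]
    | monomial n a =>
      simp only [Polynomial.eval_monomial, integral_const_mul, h n]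
  have hall : ∀ f : C(unitInterval, ℝ), ∫ x, f x ∂μ = ∫ x, f x ∂ν := fun f => by
    have hf : f ∈ (polynomialFunctions unitInterval).topologicalClosure := by
      rw [polynomialFunctions_closure_eq_top']; trivial
    refine closure_minimal ?_ hclosed hf
    rintro _ ⟨q, -, rfl⟩
    exact hpoly q
  exact ext_of_forall_integral_eq_of_IsFiniteMeasure fun f => hall f.toContinuousMap

/-- The function `z ↦ e⁻ᶻ` from `[0, ∞]` to `[0, 1]`. -/
noncomputable def negExpUnit (z : ℝ≥0∞) : unitInterval :=
  ⟨(negExp z).toReal, ENNReal.toReal_nonneg,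
    ENNReal.toReal_mono ENNReal.one_ne_top (negExp_le_one z)⟩

theorem measurable_negExpUnit : Measurable negExpUnit :=
  measurable_negExp.ennreal_toReal.subtype_mk

theorem ofReal_negExpUnit (z : ℝ≥0∞) : ENNReal.ofReal (negExpUnit z : ℝ) = negExp z :=
  ENNReal.ofReal_toReal ((negExp_le_one z).trans_lt ENNReal.one_lt_top).ne

theorem neg_log_negExp (z : ℝ≥0∞) : (-ENNReal.log (negExp z)).toENNReal = z := by
  rw [negExp, EReal.log_exp, neg_neg, EReal.toENNReal_coe]

theorem infProd_indicator (p : ℕ → ℝ≥0∞) (y : ℝ≥0∞) :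
    infProd (fun i => (Set.Iic y).indicator 1 (p i)) = (Set.Iic y).indicator 1 (⨆ i, p i) := by
  by_cases h : ∀ i, p i ≤ y
  · rw [Set.indicator_of_mem (Set.mem_Iic.2 (iSup_le h))]
    have : ∀ i, (Set.Iic y).indicator (1 : ℝ≥0∞ → ℝ≥0∞) (p i) = 1 := fun i =>
      Set.indicator_of_mem (Set.mem_Iic.2 (h i)) _
    simp [infProd, this]
  · rw [Set.indicator_of_notMem (s := Set.Iic y) (a := ⨆ i, p i)
      fun h' => h fun i => (le_iSup p i).trans h']
    push Not at h
    obtain ⟨j, hj⟩ := h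
    refine le_antisymm ((iInf_le _ (j + 1)).trans ?_) zero_le
    rw [Finset.prod_eq_zero (Finset.self_mem_range_succ j)]
    exact Set.indicator_of_notMem (fun h' => (hj.not_ge h')) _

section JointLaw

variable {Ω Ω' : Type*} [MeasurableSpace Ω] [MeasurableSpace Ω'] {P : Measure Ω}
  {P' : Measure Ω'}

/-- Both `e^(-nS)` and the indicator of `M ≤ y` are products over the points. The moments of
`e^(-S)` on `{M ≤ y}` are therefore values of the generating functional. -/
theorem integral_negExpUnit_pow_map {p : ℕ → Ω → ℝ≥0∞} (hp : ∀ i, Measurable (p i)) (y : ℝ≥0∞)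
    (n : ℕ) :
    ∫ x, (x : ℝ) ^ n ∂((P.restrict {ω | ⨆ i, p i ω ≤ y}).map fun ω => negExpUnit (∑' i, p i ω))
      = (∫⁻ ω, infProd (fun i => 1 - (1 - negExp (p i ω) ^ n * (Set.Iic y).indicator 1 (p i ω)))
          ∂P).toReal := by
  have hS : Measurable fun ω => ∑' i, p i ω := Measurable.tsum hp
  have hM : Measurable fun ω => ⨆ i, p i ω := Measurable.iSup hp
  have hY : Measurable fun ω => negExpUnit (∑' i, p i ω) := measurable_negExpUnit.comp hS
  have hset : MeasurableSet {ω | ⨆ i, p i ω ≤ y} := measurableSet_le hM measurable_const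
  have hone : ∀ z, (Set.Iic y).indicator (1 : ℝ≥0∞ → ℝ≥0∞) z ≤ 1 := fun z =>
    Set.indicator_le_self' (fun _ _ => zero_le) z
  have hpow : ∀ z, negExp z ^ n ≤ 1 := fun z => pow_le_one' (negExp_le_one z) n
  have hprod : ∀ ω,
      infProd (fun i => 1 - (1 - negExp (p i ω) ^ n * (Set.Iic y).indicator 1 (p i ω)))
        = {ω | ⨆ i, p i ω ≤ y}.indicator (fun ω => negExp (∑' i, p i ω) ^ n) ω := fun ω => by
    have h1 : ∀ i, 1 - (1 - negExp (p i ω) ^ n * (Set.Iic y).indicator 1 (p i ω))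
        = negExp (p i ω) ^ n * (Set.Iic y).indicator 1 (p i ω) := fun i =>
      ENNReal.sub_sub_cancel ENNReal.one_ne_top (mul_le_one' (hpow _) (hone _))
    simp only [h1]
    rw [infProd_mul (fun i => hpow _) (fun i => hone _), infProd_pow (fun i => negExp_le_one _),
      infProd_negExp, infProd_indicator]
    by_cases h : ⨆ i, p i ω ≤ y
    · rw [Set.indicator_of_mem (Set.mem_Iic.2 h), Set.indicator_of_mem (by exact h)]; simp
    · rw [Set.indicator_of_notMem (by exact h), Set.indicator_of_notMem (by exact h)]; simp
  simp only [hprod]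
  rw [lintegral_indicator hset, integral_map (f := fun x : unitInterval => (x : ℝ) ^ n) hY.aemeasurable
    (measurable_subtype_coe.pow_const n).aestronglyMeasurable,
    integral_eq_lintegral_of_nonneg_ae
      (Filter.Eventually.of_forall fun ω => pow_nonneg (negExpUnit _).2.1 n)
      ((measurable_subtype_coe.comp hY).pow_const n).aestronglyMeasurable]
  congr 1
  refine lintegral_congr fun ω => ?_
  rw [ENNReal.ofReal_pow (negExpUnit _).2.1, ofReal_negExpUnit]

/-- The probability generating functional of a random configuration on `(0, ∞]` determines the joint
law of the maximum and the sum of its points. -/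
theorem identDistrib_iSup_tsum [IsProbabilityMeasure P] [IsProbabilityMeasure P']
    {p : ℕ → Ω → ℝ≥0∞} {p' : ℕ → Ω' → ℝ≥0∞}
    (hp : ∀ i, Measurable (p i)) (hp' : ∀ i, Measurable (p' i))
    (h : ∀ w : ℝ≥0∞ → ℝ≥0∞, Measurable w → (∀ z, w z ≤ 1) → w 0 = 0 →
      ∫⁻ ω, infProd (fun i => 1 - w (p i ω)) ∂P = ∫⁻ ω, infProd (fun i => 1 - w (p' i ω)) ∂P') :
    IdentDistrib (fun ω => (⨆ i, p i ω, ∑' i, p i ω)) (fun ω => (⨆ i, p' i ω, ∑' i, p' i ω))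
      P P' := by
  have hS : Measurable fun ω => ∑' i, p i ω := Measurable.tsum hp
  have hM : Measurable fun ω => ⨆ i, p i ω := Measurable.iSup hp
  have hY : Measurable fun ω => negExpUnit (∑' i, p i ω) := measurable_negExpUnit.comp hS
  have hS' : Measurable fun ω => ∑' i, p' i ω := Measurable.tsum hp'
  have hM' : Measurable fun ω => ⨆ i, p' i ω := Measurable.iSup hp'
  have hY' : Measurable fun ω => negExpUnit (∑' i, p' i ω) := measurable_negExpUnit.comp hS'
  have hmom : ∀ y, (P.restrict {ω | ⨆ i, p i ω ≤ y}).map (fun ω => negExpUnit (∑' i, p i ω))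
      = (P'.restrict {ω | ⨆ i, p' i ω ≤ y}).map fun ω => negExpUnit (∑' i, p' i ω) := fun y => by
    refine Measure.ext_of_moments_unitInterval fun n => ?_
    rw [integral_negExpUnit_pow_map hp, integral_negExpUnit_pow_map hp',
      h fun z => 1 - negExp z ^ n * (Set.Iic y).indicator 1 z]
    · exact measurable_const.sub ((measurable_negExp.pow_const n).mul
        (measurable_one.indicator measurableSet_Iic))
    · exact fun z => tsub_le_self
    · simp [negExp_zero]
  have hrect : IdentDistrib (fun ω => (⨆ i, p i ω, negExpUnit (∑' i, p i ω)))
      (fun ω => (⨆ i, p' i ω, negExpUnit (∑' i, p' i ω))) P P' := by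
    refine ⟨(hM.prodMk hY).aemeasurable, (hM'.prodMk hY').aemeasurable, ?_⟩
    have := Measure.isProbabilityMeasure_map (μ := P) (hM.prodMk hY).aemeasurable
    refine Measure.ext_prod fun {s t} hs ht => ?_
    -- The roles are exchanged: the event for `e^(-S)` is now fixed, and varying the level `y`
    -- identifies the law of the maximum on it.
    have hIic : (P.restrict ((fun ω => negExpUnit (∑' i, p i ω)) ⁻¹' t)).map (fun ω => ⨆ i, p i ω)
        = (P'.restrict ((fun ω => negExpUnit (∑' i, p' i ω)) ⁻¹' t)).map
          fun ω => ⨆ i, p' i ω := by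
      refine Measure.ext_of_Iic _ _ fun y => ?_
      rw [Measure.map_apply hM measurableSet_Iic, Measure.map_apply hM' measurableSet_Iic,
        Measure.restrict_apply (hM measurableSet_Iic),
        Measure.restrict_apply (hM' measurableSet_Iic)]
      have := congrArg (fun μ => μ t) (hmom y)
      simp only [Measure.map_apply hY ht, Measure.map_apply hY' ht,
        Measure.restrict_apply (hY ht), Measure.restrict_apply (hY' ht)] at this
      rw [Set.inter_comm, Set.inter_comm (_ ⁻¹' Set.Iic y)]
      exact this
    have := congrArg (fun μ => μ s) hIic
    simp only [Measure.map_apply hM hs, Measure.map_apply hM' hs,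
      Measure.restrict_apply (hM hs), Measure.restrict_apply (hM' hs)] at this
    rw [Measure.map_apply (hM.prodMk hY) (hs.prod ht),
      Measure.map_apply (hM'.prodMk hY') (hs.prod ht)]
    exact this
  -- The sum is recovered as `S = -log e^(-S)`, also when `S = ∞`.
  have hinv : Measurable fun z : ℝ≥0∞ × unitInterval =>
      (z.1, (-ENNReal.log (ENNReal.ofReal (z.2 : ℝ))).toENNReal) :=
    measurable_fst.prodMk
      (((measurable_subtype_coe.comp measurable_snd).ennreal_ofReal.ennreal_log.neg).ereal_toENNReal)
  have := hrect.comp hinv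
  simpa only [Function.comp_def, ofReal_negExpUnit, neg_log_negExp] using this

end JointLaw

/-! ### Existence of a strongest station, and `C/I` through maximum and sum -/

/-- If some power is positive, choose a threshold below it; a maximum of the finitely many powers
above that threshold is a global maximum. -/
theorem exists_isServing {p : ℕ → ℝ≥0∞}
    (h : ∀ k : ℕ, {i | ((k : ℝ≥0∞) + 1)⁻¹ ≤ p i}.Finite) : ∃ s, IsServing p s := by
  by_cases h0 : ∀ i, p i = 0
  · exact ⟨0, fun i => by simp [h0]⟩
  push Not at h0
  obtain ⟨j, hj⟩ := h0
  obtain ⟨k, hk⟩ := ENNReal.exists_inv_nat_lt hj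
  have hkj : ((k : ℝ≥0∞) + 1)⁻¹ ≤ p j :=
    (ENNReal.inv_le_inv.2 le_self_add).trans hk.le
  obtain ⟨s, hs, hmax⟩ := (h k).exists_maximalFor p _ ⟨j, hkj⟩
  refine ⟨s, fun i => ?_⟩
  rcases le_total (p i) (p s) with hi | hi
  · exact hi
  · exact hmax (hs.trans hi) hi

/-- Finiteness of the powers permits cancelling the carrier from the total, even when the total is
infinite. -/
theorem carrierToInterference_eq {p : ℕ → ℝ≥0∞} (h : ∃ s, IsServing p s) (hp : ∀ i, p i ≠ ∞) :
    carrierToInterference p = (⨆ i, p i) / (∑' i, p i - ⨆ i, p i) := by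
  rw [carrierToInterference, dif_pos h]
  have hs : ⨆ i, p i = p h.choose := le_antisymm (iSup_le h.choose_spec) (le_iSup p _)
  have hsum : ∑' i, p i = p h.choose + ∑' i : {i : ℕ // i ≠ h.choose}, p i := by
    have := ENNReal.summable.tsum_add_tsum_compl (f := p) (s := {h.choose}) ENNReal.summable
    rw [← this, tsum_singleton]
    rfl
  rw [hs, hsum, ENNReal.add_sub_cancel_left (hp _)]

section SCS

variable {Ω : Type*} [MeasurableSpace Ω] {P : Measure Ω} {l : ℕ}
  {lam : ℝ} {X : ℕ → Ω → EuclideanSpace ℝ (Fin l)} {K Ψ : ℕ → Ω → ℝ}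

/-- For `l ≥ 1` the origin has volume zero, so it carries no point with probability `e^0 = 1`. This
excludes infinite received powers. -/
theorem IsHomogeneousPoisson.ae_ne_zero [IsProbabilityMeasure P]
    (h : IsHomogeneousPoisson l lam X P) (hl : 1 ≤ l) :
    ∀ᵐ ω ∂P, ∀ i, X i ω ≠ 0 := by
  have : Nonempty (Fin l) := ⟨⟨0, hl⟩⟩
  have hv : volume ({0} : Set (EuclideanSpace ℝ (Fin l))) = 0 := measure_singleton 0
  have h0 := h.poisson {0} (measurableSet_singleton 0) (by simp [hv]) 0
  rw [hv, poissonMeasure_singleton] at h0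
  have hmeas : MeasurableSet
      {ω | pointCount (fun i => X i ω) {(0 : EuclideanSpace ℝ (Fin l))} = (0 : ℕ)} :=
    measurable_pointCount h.measurable (measurableSet_singleton 0) (measurableSet_singleton _)
  have h1 : ∀ᵐ ω ∂P,
      pointCount (fun i => X i ω) {(0 : EuclideanSpace ℝ (Fin l))} = (0 : ℕ) := by
    rw [ae_iff]
    refine (prob_compl_eq_zero_iff hmeas).2 ?_
    rw [h0]; simp
  filter_upwards [h1] with ω hω i hi
  rw [Nat.cast_zero, pointCount, Set.encard_eq_zero] at hω
  exact (Set.eq_empty_iff_forall_notMem.1 hω i) hi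

theorem IsHomogeneousSCS.ae_receivedPower_ne_top [IsProbabilityMeasure P]
    (h : IsHomogeneousSCS l lam X K Ψ P)
    (hl : 1 ≤ l) (ε : ℝ) :
    ∀ᵐ ω ∂P, ∀ i, receivedPower ε (X i ω) (K i ω) (Ψ i ω) ≠ ∞ := by
  filter_upwards [h.poisson.ae_ne_zero hl] with ω hω i
  refine ENNReal.mul_ne_top ENNReal.ofReal_ne_top fun htop => ?_
  rcases ENNReal.rpow_eq_top_iff.1 htop with ⟨h0, -⟩ | ⟨h1, -⟩
  · exact hω i (enorm_eq_zero.1 h0)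
  · exact enorm_ne_top h1

theorem volume_le_enorm_rpow_neg_lt_top (l : ℕ) {ε : ℝ} (hε : 0 < ε) {y : ℝ≥0∞} (hy : y ≠ 0) :
    volume {x : EuclideanSpace ℝ (Fin l) | y ≤ ‖x‖ₑ ^ (-ε)} < ∞ := by
  have hR : (y⁻¹) ^ (1 / ε) ≠ ∞ :=
    ENNReal.rpow_ne_top_of_nonneg (by positivity) (ENNReal.inv_ne_top.2 hy)
  refine (measure_mono (t := Metric.closedBall 0 ((y⁻¹) ^ (1 / ε)).toReal) fun x hx => ?_).trans_lt
    measure_closedBall_lt_top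
  have hx1 : ‖x‖ₑ ^ ε ≤ y⁻¹ := by
    rw [← inv_inv (‖x‖ₑ ^ ε), ← ENNReal.rpow_neg]
    exact ENNReal.inv_le_inv.2 hx
  have hx2 : ‖x‖ₑ ≤ (y⁻¹) ^ (1 / ε) := by
    have := ENNReal.rpow_le_rpow hx1 (z := 1 / ε) (by positivity)
    rwa [← ENNReal.rpow_mul, mul_one_div_cancel hε.ne', ENNReal.rpow_one] at this
  rw [mem_closedBall_zero_iff, ← toReal_enorm]
  exact ENNReal.toReal_mono hR hx2

/-- Let `N` count the powers that are at least `y`. The weight `θ` on `[y, ∞]` gives `𝔼[(1-θ)^N] =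
e^(-cθ)` with `c` finite. Outcomes with `N = ∞` contribute `0`, so `e^(-cθ) ≤ P(N < ∞)`; now let `θ
→ 0`. -/
theorem IsHomogeneousSCS.ae_finite_le_receivedPower [IsProbabilityMeasure P]
    (h : IsHomogeneousSCS l lam X K Ψ P)
    (hl : 1 ≤ l) {ε : ℝ} (hε : 0 < ε)
    (hA : ∫⁻ ω, ENNReal.ofReal (K 0 ω * Ψ 0 ω) ^ ((l : ℝ) / ε) ∂P ≠ ∞) {y : ℝ≥0∞} (hy : y ≠ 0) :
    ∀ᵐ ω ∂P, {i | y ≤ receivedPower ε (X i ω) (K i ω) (Ψ i ω)}.Finite := by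
  classical
  set N : Ω → ℕ∞ := fun ω =>
    pointCount (fun i => receivedPower ε (X i ω) (K i ω) (Ψ i ω)) (Set.Ici y) with hN
  have hNm : Measurable N := measurable_pointCount (h.measurable_receivedPower ε) measurableSet_Ici
  have hNset : MeasurableSet {ω | N ω ≠ ⊤} := hNm (MeasurableSet.of_discrete (s := {⊤}ᶜ))
  set c : ℝ≥0∞ := ENNReal.ofReal lam *
    ((∫⁻ ω, ENNReal.ofReal (K 0 ω * Ψ 0 ω) ^ ((l : ℝ) / ε) ∂P) *
      volume {x : EuclideanSpace ℝ (Fin l) | y ≤ ‖x‖ₑ ^ (-ε)}) with hc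
  have hctop : c ≠ ∞ := ENNReal.mul_ne_top ENNReal.ofReal_ne_top
    (ENNReal.mul_ne_top hA (volume_le_enorm_rpow_neg_lt_top l hε hy).ne)
  have hbound : ∀ θ : ℝ≥0∞, θ ≠ 0 → θ ≤ 1 → negExp (c * θ) ≤ P {ω | N ω ≠ ⊤} := fun θ hθ hθ1 => by
    have hpgf := h.lintegral_infProd_receivedPower hl hε
      (w := (Set.Ici y).indicator fun _ => θ) (measurable_const.indicator measurableSet_Ici)
      (fun p => (Set.indicator_le_self' (fun _ _ => zero_le) p).trans hθ1)
      (Set.indicator_of_notMem (by simpa using hy) _)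
    have hW : ∫⁻ x : EuclideanSpace ℝ (Fin l), (Set.Ici y).indicator (fun _ => θ) (‖x‖ₑ ^ (-ε))
        = θ * volume {x : EuclideanSpace ℝ (Fin l) | y ≤ ‖x‖ₑ ^ (-ε)} := by
      have hm : Measurable fun x : EuclideanSpace ℝ (Fin l) => ‖x‖ₑ ^ (-ε) :=
        measurable_enorm.pow_const _
      rw [← lintegral_indicator_const (measurableSet_le measurable_const hm)]
      rfl
    rw [hW] at hpgf
    have hcθ : c * θ = ENNReal.ofReal lam *
        ((∫⁻ ω, ENNReal.ofReal (K 0 ω * Ψ 0 ω) ^ ((l : ℝ) / ε) ∂P) *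
          (θ * volume {x : EuclideanSpace ℝ (Fin l) | y ≤ ‖x‖ₑ ^ (-ε)})) := by
      rw [hc]; ring
    rw [hcθ, ← hpgf, ← lintegral_indicator_one hNset]
    refine lintegral_mono fun ω => ?_
    have hite : (fun i => 1 - (Set.Ici y).indicator (fun _ => θ)
        (receivedPower ε (X i ω) (K i ω) (Ψ i ω)))
        = fun i => if receivedPower ε (X i ω) (K i ω) (Ψ i ω) ∈ Set.Ici y then 1 - θ else 1 := by
      ext i
      rw [Set.indicator_apply]
      split_ifs <;> simp
    dsimp only
    rw [hite]
    by_cases hω : N ω = ⊤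
    · rw [infProd_ite (fun i => receivedPower ε (X i ω) (K i ω) (Ψ i ω)) (Set.Ici y) tsub_le_self]
      change enatPow (1 - θ) (N ω) ≤ _
      rw [hω]
      refine le_trans (le_of_eq ?_) zero_le
      have hlim := ENNReal.tendsto_pow_atTop_nhds_zero_of_lt_one
        (ENNReal.sub_lt_self ENNReal.one_ne_top one_ne_zero hθ)
      refine le_antisymm (ge_of_tendsto' hlim fun n => ?_) zero_le
      exact iInf₂_le (f := fun n (_ : ((n : ℕ) : ℕ∞) ≤ ⊤) => (1 - θ) ^ n) n le_top
    · rw [Set.indicator_of_mem (by exact hω)]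
      exact infProd_le_one _
  have hone : P {ω | N ω ≠ ⊤} = 1 := by
    refine le_antisymm prob_le_one ?_
    have hθ : Filter.Tendsto (fun k : ℕ => ((k : ℝ≥0∞) + 1)⁻¹) Filter.atTop (nhds 0) := by
      have := (Filter.tendsto_add_atTop_iff_nat 1).2 ENNReal.tendsto_inv_nat_nhds_zero
      simpa using this
    have hlim := (continuous_negExp.tendsto _).comp
      (ENNReal.Tendsto.const_mul hθ (Or.inr hctop))
    rw [mul_zero, negExp_zero] at hlim
    refine le_of_tendsto' hlim fun k => hbound _ ?_ ?_
    · exact ENNReal.inv_ne_zero.2 (by finiteness)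
    · exact ENNReal.inv_le_one.2 le_add_self
  have hae : ∀ᵐ ω ∂P, N ω ≠ ⊤ := (prob_compl_eq_zero_iff hNset).2 hone
  filter_upwards [hae] with ω hω
  exact Set.encard_ne_top_iff.1 hω

theorem IsHomogeneousSCS.ae_exists_isServing [IsProbabilityMeasure P]
    (h : IsHomogeneousSCS l lam X K Ψ P)
    (hl : 1 ≤ l) {ε : ℝ} (hε : 0 < ε)
    (hA : ∫⁻ ω, ENNReal.ofReal (K 0 ω * Ψ 0 ω) ^ ((l : ℝ) / ε) ∂P ≠ ∞) :
    ∀ᵐ ω ∂P, ∃ s, IsServing (fun i => receivedPower ε (X i ω) (K i ω) (Ψ i ω)) s := by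
  have : ∀ᵐ ω ∂P, ∀ k : ℕ,
      {i | ((k : ℝ≥0∞) + 1)⁻¹ ≤ receivedPower ε (X i ω) (K i ω) (Ψ i ω)}.Finite :=
    ae_all_iff.2 fun k => h.ae_finite_le_receivedPower hl hε hA
      (ENNReal.inv_ne_zero.2 (by finiteness))
  filter_upwards [this] with ω hω using exists_isServing hω

theorem IsHomogeneousSCS.lintegral_rpow_ne_top (h : IsHomogeneousSCS l lam X K Ψ P) {r : ℝ}
    (hr : 0 ≤ r) (hint : Integrable (fun ω => (Ψ 0 ω * K 0 ω) ^ r) P) :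
    ∫⁻ ω, ENNReal.ofReal (K 0 ω * Ψ 0 ω) ^ r ∂P ≠ ∞ := by
  refine ne_of_eq_of_ne (lintegral_congr_ae ?_) hint.lintegral_lt_top.ne
  filter_upwards [h.power_nonneg 0, h.fading_nonneg 0] with ω hK hΨ
  rw [mul_comm, ENNReal.ofReal_rpow_of_nonneg (mul_nonneg hΨ hK) hr]

theorem IsHomogeneousSCS.lintegral_rpow_ne_zero (h : IsHomogeneousSCS l lam X K Ψ P) {r : ℝ}
    (hr : 0 < r) (hpos : 0 < P {ω | 0 < Ψ 0 ω * K 0 ω}) :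
    ∫⁻ ω, ENNReal.ofReal (K 0 ω * Ψ 0 ω) ^ r ∂P ≠ 0 := fun h0 => by
  have hm : Measurable fun ω => ENNReal.ofReal (K 0 ω * Ψ 0 ω) ^ r :=
    ((h.measurable_power 0).mul (h.measurable_fading 0)).ennreal_ofReal.pow_const _
  have hae := (lintegral_eq_zero_iff hm).1 h0
  refine hpos.ne' (measure_mono_null (fun ω hω => ?_) (ae_iff.1 hae))
  intro h1
  have h2 : ENNReal.ofReal (K 0 ω * Ψ 0 ω) = 0 := (ENNReal.rpow_eq_zero_iff_of_pos hr).1 h1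
  rw [mul_comm, ENNReal.ofReal_eq_zero] at h2
  exact absurd hω h2.not_gt

theorem IsHomogeneousSCS.cOverI_ae_eq [IsProbabilityMeasure P]
    (h : IsHomogeneousSCS l lam X K Ψ P)
    (hl : 1 ≤ l) {ε : ℝ} (hε : 0 < ε)
    (hA : ∫⁻ ω, ENNReal.ofReal (K 0 ω * Ψ 0 ω) ^ ((l : ℝ) / ε) ∂P ≠ ∞) :
    cOverI ε X K Ψ =ᵐ[P] fun ω => (⨆ i, receivedPower ε (X i ω) (K i ω) (Ψ i ω)) /
      (∑' i, receivedPower ε (X i ω) (K i ω) (Ψ i ω)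
        - ⨆ i, receivedPower ε (X i ω) (K i ω) (Ψ i ω)) := by
  filter_upwards [h.ae_exists_isServing hl hε hA, h.ae_receivedPower_ne_top hl ε] with ω h1 h2
  exact carrierToInterference_eq h1 h2

end SCS

/-! ### Comparison of the two systems -/

theorem mainTheorem9 {Ω Ω' : Type*} [MeasurableSpace Ω] [MeasurableSpace Ω']
    (P : Measure Ω) [IsProbabilityMeasure P] (P' : Measure Ω') [IsProbabilityMeasure P']
    (l : ℕ) (hl : 1 ≤ l) (lam : ℝ) (hlam : 0 < lam) (ε : ℝ) (hε : 0 < ε)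
    (X : ℕ → Ω → EuclideanSpace ℝ (Fin l)) (K Ψ : ℕ → Ω → ℝ)
    (X' : ℕ → Ω' → EuclideanSpace ℝ (Fin l)) (K' Ψ' : ℕ → Ω' → ℝ)
    (hS : IsHomogeneousSCS l lam X K Ψ P) (hS' : IsHomogeneousSCS l lam X' K' Ψ' P')
    (hpos : 0 < P {ω | 0 < Ψ 0 ω * K 0 ω}) (hpos' : 0 < P' {ω | 0 < Ψ' 0 ω * K' 0 ω})
    (hint : Integrable (fun ω => (Ψ 0 ω * K 0 ω) ^ ((l : ℝ) / ε)) P)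
    (hint' : Integrable (fun ω => (Ψ' 0 ω * K' 0 ω) ^ ((l : ℝ) / ε)) P') :
    (∀ᵐ ω ∂P, ∃ s, IsServing (fun i => receivedPower ε (X i ω) (K i ω) (Ψ i ω)) s) ∧
    (∀ᵐ ω ∂P', ∃ s, IsServing (fun i => receivedPower ε (X' i ω) (K' i ω) (Ψ' i ω)) s) ∧
    IdentDistrib (cOverI ε X K Ψ) (cOverI ε X' K' Ψ') P P' := by
  have hr : 0 < (l : ℝ) / ε := div_pos (by exact_mod_cast hl) hε
  have hAtop := hS.lintegral_rpow_ne_top hr.le hint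
  have hAtop' := hS'.lintegral_rpow_ne_top hr.le hint'
  have hA0 := hS.lintegral_rpow_ne_zero hr hpos
  have hA0' := hS'.lintegral_rpow_ne_zero hr hpos'
  refine ⟨hS.ae_exists_isServing hl hε hAtop, hS'.ae_exists_isServing hl hε hAtop', ?_⟩
  have hpgf := fun w (hw : Measurable w) hw1 hw0 =>
    hS.lintegral_infProd_receivedPower hl hε (w := w) hw hw1 hw0
  have hpgf' := fun w (hw : Measurable w) hw1 hw0 =>
    hS'.lintegral_infProd_receivedPower hl hε (w := w) hw hw1 hw0
  have hae := hS.cOverI_ae_eq hl hε hAtop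
  have hae' := hS'.cOverI_ae_eq hl hε hAtop'
  set A := ∫⁻ ω, ENNReal.ofReal (K 0 ω * Ψ 0 ω) ^ ((l : ℝ) / ε) ∂P
  set A' := ∫⁻ ω, ENNReal.ofReal (K' 0 ω * Ψ' 0 ω) ^ ((l : ℝ) / ε) ∂P'
  have hp := hS.measurable_receivedPower ε
  have hp' := hS'.measurable_receivedPower ε
  set p : ℕ → Ω → ℝ≥0∞ := fun i ω => receivedPower ε (X i ω) (K i ω) (Ψ i ω)
  set p' : ℕ → Ω' → ℝ≥0∞ := fun i ω => receivedPower ε (X' i ω) (K' i ω) (Ψ' i ω)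
  have hq0 : A / A' ≠ 0 := ENNReal.div_ne_zero.2 ⟨hA0, hAtop'⟩
  have hqtop : A / A' ≠ ∞ := ENNReal.div_ne_top hAtop hA0'
  -- The scale `a = (A/A')^(ε/l)` is where positivity and finiteness of both moments are needed.
  obtain ⟨a, ha0, hatop, haA⟩ : ∃ a : ℝ≥0∞, a ≠ 0 ∧ a ≠ ∞ ∧ A' * a ^ ((l : ℝ) / ε) = A := by
    refine ⟨(A / A') ^ ((l : ℝ) / ε)⁻¹, ?_, ?_, ?_⟩
    · exact (ENNReal.rpow_pos (pos_iff_ne_zero.2 hq0) hqtop).ne'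
    · exact ENNReal.rpow_ne_top_of_nonneg (inv_nonneg.2 hr.le) hqtop
    · rw [← ENNReal.rpow_mul, inv_mul_cancel₀ hr.ne', ENNReal.rpow_one,
        ENNReal.mul_div_cancel hA0' hAtop']
  have hjoint := identDistrib_iSup_tsum (P := P) (P' := P') (p := p) (p' := fun i ω => a * p' i ω)
    hp (fun i => (hp' i).const_mul a) fun w hw hw1 hw0 => by
      rw [hpgf w hw hw1 hw0, hpgf' (fun z => w (a * z)) (hw.comp (measurable_const_mul a))
        (fun z => hw1 _) (by simpa using hw0), lintegral_comp_mul_enorm_rpow hl hε hw hw0 hatop,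
        ← mul_assoc A', haA]
  have hratio : Measurable fun z : ℝ≥0∞ × ℝ≥0∞ => z.1 / (z.2 - z.1) :=
    measurable_fst.div (measurable_snd.sub measurable_fst)
  have hfinal := hjoint.comp hratio
  -- The factor `a` cancels in `M / (S - M)`, so the rescaled second system has the ratio of the
  -- original one.
  have hscale : ((fun z : ℝ≥0∞ × ℝ≥0∞ => z.1 / (z.2 - z.1)) ∘
      fun ω => (⨆ i, a * p' i ω, ∑' i, a * p' i ω))
      = fun ω => (⨆ i, p' i ω) / (∑' i, p' i ω - ⨆ i, p' i ω) := by
    ext ω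
    simp only [Function.comp_apply]
    rw [← ENNReal.mul_iSup, ENNReal.tsum_mul_left, ← ENNReal.mul_sub fun _ _ => hatop,
      ENNReal.mul_div_mul_left _ _ ha0 hatop]
  rw [hscale] at hfinal
  have hmeas : Measurable fun ω => (⨆ i, p i ω) / (∑' i, p i ω - ⨆ i, p i ω) :=
    hratio.comp ((Measurable.iSup hp).prodMk (Measurable.tsum hp))
  have hmeas' : Measurable fun ω => (⨆ i, p' i ω) / (∑' i, p' i ω - ⨆ i, p' i ω) :=
    hratio.comp ((Measurable.iSup hp').prodMk (Measurable.tsum hp'))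
  exact ((IdentDistrib.of_ae_eq hmeas.aemeasurable hae.symm).symm.trans hfinal).trans
    (IdentDistrib.of_ae_eq hmeas'.aemeasurable hae'.symm)
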